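/- Let $D$ be a division ring that is algebraically closed, meaning that every nonconstant polynomial $f=\sum_i f_i x^i\in D[x]$ (with $x$ a central variable) has a zero in $D$, i.e. an element $a \in D$ with $f(a)=\sum_i f_i a^i=0$. Write $D[x_1,\ldots,x_n]$ for the ring of polynomials in $n$ central variables over $D$. Then the following are equivalent: (1) $D$ is a Nullstellensatz ring: for every $n\ge 1$, the maximal left ideals of $D[x_1,\ldots,x_n]$ are precisely the left ideals $\langle x_1-a_1,\ldots,x_n-a_n\rangle$ with $(a_1,\ldots,a_n)\in D^n$ such that $a_ia_j=a_ja_i$ for all $1\le i,j\le n$. (2) $D$ is an Amitsur–Small ring: for all $1\le k\le n$ and every maximal left ideal $M$ of $D[x_1,\ldots,x_n]$, the intersection $M\cap D[x_1,\ldots,x_k]$ is a maximal left ideal of $D[x_1,\ldots,x_k]$. -/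

import Mathlib

noncomputable section

/-- The ring `D[x_1, …, x_n]` of polynomials in `n` central variables over a (not necessarily
commutative) ring `D`. Mathlib's `MvPolynomial (Fin n) D` is the same monoid algebra, restricted to
commutative `D`. Since multiplication is not commutative, `Ideal` means left ideal here. -/
abbrev CentralPoly (n : ℕ) (D : Type*) [Ring D] : Type _ :=
  AddMonoidAlgebra D (Fin n →₀ ℕ)

namespace CentralPoly

/-- The central variable `x_i`. -/
def X {n : ℕ} {D : Type*} [Ring D] (i : Fin n) : CentralPoly n D :=
  AddMonoidAlgebra.single (Finsupp.single i 1) 1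

/-- The constant polynomial with value `a`. -/
def C {n : ℕ} {D : Type*} [Ring D] (a : D) : CentralPoly n D :=
  AddMonoidAlgebra.single 0 a

/-- The left ideal `⟨x_1 - a_1, …, x_n - a_n⟩` of `D[x_1, …, x_n]`. -/
def pointIdeal {n : ℕ} {D : Type*} [Ring D] (a : Fin n → D) : Ideal (CentralPoly n D) :=
  Ideal.span (Set.range fun i => X i - C (a i))

/-- The inclusion of `D[x_1, …, x_k]` into `D[x_1, …, x_n]` for `k ≤ n`. -/
def inclusion (D : Type*) [Ring D] {k n : ℕ} (h : k ≤ n) : CentralPoly k D →+* CentralPoly n D :=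
  AddMonoidAlgebra.mapDomainRingHom D (Finsupp.mapDomain.addMonoidHom (Fin.castLE h))

end CentralPoly

/-- Every nonconstant polynomial in `D[x]` has a zero in `D`. Here `Polynomial.eval` is
substitution with the coefficients on the left. -/
def IsAlgClosedDivisionRing (D : Type*) [DivisionRing D] : Prop :=
  ∀ p : Polynomial D, 0 < p.degree → ∃ a : D, p.eval a = 0

/-- For every `n ≥ 1`, the maximal left ideals of `D[x_1, …, x_n]` are exactly the left ideals
`⟨x_1 - a_1, …, x_n - a_n⟩` for points with pairwise commuting coordinates. -/
def IsNullstellensatzRing (D : Type*) [DivisionRing D] : Prop :=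
  ∀ n : ℕ, 1 ≤ n → ∀ M : Ideal (CentralPoly n D),
    M.IsMaximal ↔
      ∃ a : Fin n → D, (∀ i j, a i * a j = a j * a i) ∧ M = CentralPoly.pointIdeal a

/-- For all `1 ≤ k ≤ n`, every maximal left ideal of `D[x_1, …, x_n]` intersects
`D[x_1, …, x_k]` in a maximal left ideal of the latter. -/
def IsAmitsurSmallRing (D : Type*) [DivisionRing D] : Prop :=
  ∀ (k n : ℕ) (_ : 1 ≤ k) (h : k ≤ n) (M : Ideal (CentralPoly n D)),
    M.IsMaximal → (M.comap (CentralPoly.inclusion D h)).IsMaximal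

end

/-!
The heart of the matter is that `pointIdeal a` is a maximal left ideal as soon as the coordinates of
`a` commute (`CentralPoly.pointIdeal_isMaximal`). Modulo `pointIdeal a` every polynomial is a
constant, and constants are units or zero, so only properness is at stake; it is witnessed by the
evaluation at `a` with coefficients on the left, whose kernel is a left ideal because the values of
the monomials at `a` commute with every coordinate.

If `D` is a Nullstellensatz ring, then a maximal left ideal `pointIdeal a` meets `D[x_1, …, x_k]` in
a proper left ideal containing the point ideal of the truncation of `a`, which is maximal.

Conversely, let `D` be an Amitsur–Small ring and `M` a maximal left ideal. After exchanging `x_1` and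
`x_i`, the case `k = 1` shows that `M ∩ D[x_i]` is maximal. Left division with remainder makes it
principal, generated by some nonconstant `p`; a zero `a_i` of `p` gives `p ∈ D[x_i](x_i - a_i)`,
so `x_i - a_i ∈ M` by maximality. The commutator of `x_i - a_i` and `x_j - a_j` is the constant
`a_i a_j - a_j a_i`, which lies in the proper left ideal `M` and hence vanishes. Therefore
`pointIdeal a ≤ M` is maximal, and the two coincide.
-/

/-! ### Left ideals in one variable -/

namespace Polynomial

variable {D : Type*}

/-- The remainder theorem for coefficients on the left. -/
theorem sub_C_eval_mem_span_X_sub_C [Ring D] (a : D) (p : Polynomial D) :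
    p - C (p.eval a) ∈ Ideal.span {X - C a} := by
  induction p using Polynomial.induction_on' with
  | add p q hp hq =>
    rw [eval_add, C_add, add_sub_add_comm]
    exact add_mem hp hq
  | monomial n c =>
    have h : monomial n c - C ((monomial n c).eval a) = C c * (X ^ n - C a ^ n) := by
      rw [eval_monomial, C_mul, C_pow, mul_sub, C_mul_X_pow_eq_monomial]
    rw [h, ← (commute_X (C a)).geom_sum₂_mul n, ← mul_assoc]
    exact Ideal.mul_mem_left _ _ (Ideal.subset_span rfl)

theorem span_X_sub_C_ne_top [Ring D] [Nontrivial D] (a : D) :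
    Ideal.span {(X - C a : Polynomial D)} ≠ ⊤ := by
  rw [Ne, Ideal.eq_top_iff_one, Ideal.mem_span_singleton']
  rintro ⟨q, hq⟩
  simpa [eval_mul_X_sub_C] using congrArg (eval a) hq

/-- A nonzero element of least degree in a left ideal over a division ring generates it. -/
theorem le_span_singleton_of_forall_degree_le [DivisionRing D] {N : Ideal (Polynomial D)}
    {p : Polynomial D} (hpN : p ∈ N) (hp0 : p ≠ 0)
    (hmin : ∀ q ∈ N, q ≠ 0 → p.degree ≤ q.degree) : N ≤ Ideal.span {p} := by
  intro f
  induction f using degree_lt_wf.induction with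
  | h f ih =>
  intro hf
  by_cases hf0 : f = 0
  · rw [hf0]
    exact zero_mem _
  -- The leading term of `g` cancels that of `f`.
  set g : Polynomial D :=
    monomial (f.natDegree - p.natDegree) (f.leadingCoeff * p.leadingCoeff⁻¹) * p with hg
  have hlp : p.leadingCoeff ≠ 0 := leadingCoeff_ne_zero.2 hp0
  have hlf : f.leadingCoeff ≠ 0 := leadingCoeff_ne_zero.2 hf0
  have hc : f.leadingCoeff * p.leadingCoeff⁻¹ ≠ 0 := mul_ne_zero hlf (inv_ne_zero hlp)
  have hle : p.natDegree ≤ f.natDegree := natDegree_le_natDegree (hmin f hf hf0)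
  have hdeg : f.degree = g.degree := by
    rw [hg, degree_mul, degree_monomial _ hc, degree_eq_natDegree hf0, degree_eq_natDegree hp0,
      ← Nat.cast_add, Nat.sub_add_cancel hle]
  have hlead : f.leadingCoeff = g.leadingCoeff := by
    rw [hg, leadingCoeff_mul, leadingCoeff_monomial, mul_assoc, inv_mul_cancel₀ hlp, mul_one]
  have hgN : g ∈ N := N.mul_mem_left _ hpN
  have hgp : g ∈ Ideal.span {p} := Ideal.mul_mem_left _ _ (Ideal.subset_span rfl)
  have := ih (f - g) (degree_sub_lt_left hdeg hf0 hlead) (sub_mem hf hgN)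
  simpa using add_mem this hgp

/-- Over an algebraically closed division ring, every maximal left ideal of `D[X]` contains some
`X - a`. -/
theorem exists_X_sub_C_mem_of_isMaximal [DivisionRing D] (hD : IsAlgClosedDivisionRing D)
    {N : Ideal (Polynomial D)} (hN : N.IsMaximal) : ∃ a : D, X - C a ∈ N := by
  have hbot : N ≠ ⊥ := by
    rintro rfl
    have h := hN.eq_of_le (span_X_sub_C_ne_top (0 : D)) bot_le
    exact X_sub_C_ne_zero (0 : D)
      ((Submodule.mem_bot _).1 (h ▸ Ideal.subset_span (Set.mem_singleton _)))
  obtain ⟨p₀, hp₀N, hp₀⟩ := Submodule.exists_mem_ne_zero_of_ne_bot hbot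
  obtain ⟨p, ⟨hpN, hp0⟩, hmin⟩ := WellFounded.has_min degree_lt_wf
    {q : Polynomial D | q ∈ N ∧ q ≠ 0} ⟨p₀, hp₀N, hp₀⟩
  have hdeg : 0 < p.degree := by
    by_contra! h
    rw [eq_C_of_degree_le_zero h] at hpN hp0
    have hc : p.coeff 0 ≠ 0 := fun h0 => hp0 (by rw [h0, C_0])
    refine hN.ne_top (Ideal.eq_top_of_unit_mem N _ (C (p.coeff 0)⁻¹) hpN ?_)
    rw [← C_mul, inv_mul_cancel₀ hc, C_1]
  obtain ⟨a, ha⟩ := hD p hdeg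
  have hpa : p ∈ Ideal.span {X - C a} := by
    simpa [ha] using sub_C_eval_mem_span_X_sub_C a p
  have hle : N ≤ Ideal.span {X - C a} :=
    (le_span_singleton_of_forall_degree_le hpN hp0
      fun q hq hq0 => not_lt.1 (hmin q ⟨hq, hq0⟩)).trans
      ((Ideal.span_singleton_le_iff_mem _).2 hpa)
  refine ⟨a, ?_⟩
  rw [hN.eq_of_le (span_X_sub_C_ne_top a) hle]
  exact Ideal.subset_span rfl

end Polynomial

namespace CentralPoly

section Ring

variable {n : ℕ} {D : Type*} [Ring D]

/-! ### Constants and variables -/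

theorem C_mul_single (c d : D) (m : Fin n →₀ ℕ) :
    C c * AddMonoidAlgebra.single m d = AddMonoidAlgebra.single m (c * d) := by
  simp [C, AddMonoidAlgebra.single_mul_single]

theorem C_mul_C (c d : D) : (C c * C d : CentralPoly n D) = C (c * d) :=
  C_mul_single c d 0

theorem C_sub (c d : D) : (C (c - d) : CentralPoly n D) = C c - C d :=
  AddMonoidAlgebra.single_sub ..

theorem C_one : (C 1 : CentralPoly n D) = 1 := rfl

theorem X_mul_C (i : Fin n) (c : D) : X i * C c = C c * X i := by
  simp [C, X, AddMonoidAlgebra.single_mul_single]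

theorem X_mul_X (i j : Fin n) : (X i * X j : CentralPoly n D) = X j * X i := by
  simp [X, AddMonoidAlgebra.single_mul_single, add_comm]

/-- The commutator of two generators of a point ideal is a constant. -/
theorem commutator_X_sub_C (i j : Fin n) (a b : D) :
    (X i - C a) * (X j - C b) - (X j - C b) * (X i - C a) = C (a * b - b * a) := by
  simp only [sub_mul, mul_sub, X_mul_X j i, X_mul_C, C_mul_C, C_sub]
  abel

/-! ### Point ideals and evaluation -/

theorem X_sub_C_mem_pointIdeal (a : Fin n → D) (i : Fin n) : X i - C (a i) ∈ pointIdeal a :=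
  Ideal.subset_span ⟨i, rfl⟩

theorem pointIdeal_le_iff {a : Fin n → D} {M : Ideal (CentralPoly n D)} :
    pointIdeal a ≤ M ↔ ∀ i, X i - C (a i) ∈ M := by
  rw [pointIdeal, Ideal.span_le, Set.range_subset_iff]
  rfl

theorem exists_single_sub_C_mem_pointIdeal (a : Fin n → D) (m : Fin n →₀ ℕ) (c : D) :
    ∃ d : D, AddMonoidAlgebra.single m c - C d ∈ pointIdeal a := by
  have hadd (m₁ m₂ : Fin n →₀ ℕ)
      (h₁ : ∀ c : D, ∃ d : D, AddMonoidAlgebra.single m₁ c - C d ∈ pointIdeal a)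
      (h₂ : ∀ c : D, ∃ d : D, AddMonoidAlgebra.single m₂ c - C d ∈ pointIdeal a) (c : D) :
      ∃ d : D, AddMonoidAlgebra.single (m₁ + m₂) c - C d ∈ pointIdeal a := by
    obtain ⟨d₂, hd₂⟩ := h₂ c
    obtain ⟨d₁, hd₁⟩ := h₁ d₂
    refine ⟨d₁, ?_⟩
    convert! add_mem (Ideal.mul_mem_left _ (AddMonoidAlgebra.single m₁ 1) hd₂) hd₁ using 1
    simp [mul_sub, C, AddMonoidAlgebra.single_mul_single]
  induction m using Finsupp.induction_linear generalizing c with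
  | zero =>
    refine ⟨c, ?_⟩
    rw [C, sub_self]
    exact zero_mem _
  | add m₁ m₂ h₁ h₂ => exact hadd m₁ m₂ h₁ h₂ c
  | single i k =>
    induction k generalizing c with
    | zero =>
      refine ⟨c, ?_⟩
      rw [Finsupp.single_zero, C, sub_self]
      exact zero_mem _
    | succ k ih =>
      rw [Finsupp.single_add]
      refine hadd _ _ ih (fun c => ⟨c * a i, ?_⟩) c
      convert! Ideal.mul_mem_left _ (C c) (X_sub_C_mem_pointIdeal a i) using 1
      rw [mul_sub, X, C_mul_single, C_mul_C, mul_one]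

/-- Every polynomial is constant modulo a point ideal. -/
theorem exists_sub_C_mem_pointIdeal (a : Fin n → D) (f : CentralPoly n D) :
    ∃ d : D, f - C d ∈ pointIdeal a := by
  induction f using AddMonoidAlgebra.induction_linear with
  | zero => exact ⟨0, by simp [C]⟩
  | add f g hf hg =>
    obtain ⟨c, hc⟩ := hf
    obtain ⟨d, hd⟩ := hg
    refine ⟨c + d, ?_⟩
    convert! add_mem hc hd using 1
    simp [C, add_sub_add_comm]
  | single m c => exact exists_single_sub_C_mem_pointIdeal a m c

open scoped IsMulCommutative in
/-- The values of the monomials at a point with commuting coordinates form a monoid homomorphism on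
the exponents. -/
theorem exists_monomialValue {a : Fin n → D} (ha : ∀ i j, a i * a j = a j * a i) :
    ∃ φ : Multiplicative (Fin n →₀ ℕ) →* D,
      ∀ i, φ (Multiplicative.ofAdd (Finsupp.single i 1)) = a i := by
  -- The coordinates generate a commutative submonoid, where products of powers make sense.
  have := Submonoid.isMulCommutative_closure D (s := Set.range a)
    (by rintro _ ⟨i, rfl⟩ _ ⟨j, rfl⟩; exact ha i j)
  let b : Fin n → Submonoid.closure (Set.range a) :=
    fun i => ⟨a i, Submonoid.subset_closure ⟨i, rfl⟩⟩
  let ψ : Multiplicative (Fin n →₀ ℕ) →* Submonoid.closure (Set.range a) :=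
    { toFun := fun m => m.toAdd.prod fun i k => b i ^ k
      map_one' := Finsupp.prod_zero_index
      map_mul' := fun m₁ m₂ =>
        Finsupp.prod_add_index' (fun _ => pow_zero _) (fun _ => pow_add _) }
  refine ⟨(Submonoid.closure (Set.range a)).subtype.comp ψ, fun i => ?_⟩
  have h : ψ (Multiplicative.ofAdd (Finsupp.single i 1)) = b i :=
    (Finsupp.prod_single_index (h := fun i k => b i ^ k) (pow_zero (b i))).trans (pow_one (b i))
  exact congrArg Subtype.val h

theorem pointIdeal_ne_top [Nontrivial D] {a : Fin n → D} (ha : ∀ i j, a i * a j = a j * a i) :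
    pointIdeal a ≠ ⊤ := by
  obtain ⟨φ, hφ⟩ := exists_monomialValue ha
  -- Evaluation at `a` with coefficients on the left; additive, but in general not multiplicative.
  let ev : CentralPoly n D →+ D := AddMonoidAlgebra.liftNC (AddMonoidHom.id D) φ
  have hev (m : Fin n →₀ ℕ) (c : D) :
      ev (AddMonoidAlgebra.single m c) = c * φ (Multiplicative.ofAdd m) :=
    AddMonoidAlgebra.liftNC_single _ _ _ _
  have hmul (f g : CentralPoly n D) (hg : ev g = 0) : ev (f * g) = 0 := by
    induction f using AddMonoidAlgebra.induction_linear with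
    | zero => rw [zero_mul, map_zero]
    | add f₁ f₂ h₁ h₂ => rw [add_mul, map_add, h₁, h₂, add_zero]
    | single m c =>
      have h : ev (AddMonoidAlgebra.single m c * g) =
          c * ev g * φ (Multiplicative.ofAdd m) := by
        clear hg
        induction g using AddMonoidAlgebra.induction_linear with
        | zero => simp
        | add g₁ g₂ h₁ h₂ => rw [mul_add, map_add, h₁, h₂, map_add, mul_add, add_mul]
        | single m' c' =>
          rw [AddMonoidAlgebra.single_mul_single, hev, hev, add_comm m m', ofAdd_add, map_mul]
          simp only [mul_assoc]
      rw [h, hg, mul_zero, zero_mul]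
  let K : Ideal (CentralPoly n D) :=
    { carrier := {f | ev f = 0}
      zero_mem' := map_zero ev
      add_mem' := fun {f g} hf hg => by
        change ev (f + g) = 0
        rw [map_add, show ev f = 0 from hf, show ev g = 0 from hg, add_zero]
      smul_mem' := fun f g hg => hmul f g hg }
  have hle : pointIdeal a ≤ K := pointIdeal_le_iff.2 fun i => by
    change ev (X i - C (a i)) = 0
    rw [map_sub, X, C, hev, hev, hφ, ofAdd_zero, map_one, one_mul, mul_one, sub_self]
  intro htop
  have h1 : ev (C 1) = 0 := hle (htop ▸ Submodule.mem_top)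
  rw [C, hev, ofAdd_zero, map_one, one_mul] at h1
  exact one_ne_zero h1

/-! ### Ring homomorphisms between polynomial rings -/

theorem inclusion_X {k : ℕ} (h : k ≤ n) (i : Fin k) :
    inclusion D h (X i) = X (Fin.castLE h i) := by
  simp [inclusion, X]

theorem inclusion_C {k : ℕ} (h : k ≤ n) (c : D) : inclusion D h (C c) = C c := by
  simp [inclusion, C]

/-- The ring homomorphism `D[X] → D[x_1, …, x_n]` sending `X` to `x_i`. -/
noncomputable def ofPolynomial (i : Fin n) : Polynomial D →+* CentralPoly n D :=
  Polynomial.eval₂RingHom' AddMonoidAlgebra.singleZeroRingHom (X i) fun c => (X_mul_C i c).symm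

theorem ofPolynomial_X (i : Fin n) : ofPolynomial (D := D) i Polynomial.X = X i :=
  Polynomial.eval₂_X _ _

theorem ofPolynomial_C (i : Fin n) (c : D) : ofPolynomial i (Polynomial.C c) = C c :=
  Polynomial.eval₂_C _ _

theorem ofPolynomial_surjective : Function.Surjective (ofPolynomial (D := D) (0 : Fin 1)) := by
  intro f
  induction f using AddMonoidAlgebra.induction_linear with
  | zero => exact ⟨0, map_zero _⟩
  | add f g hf hg =>
    obtain ⟨p, rfl⟩ := hf
    obtain ⟨q, rfl⟩ := hg
    exact ⟨p + q, map_add _ _ _⟩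
  | single m c =>
    refine ⟨Polynomial.C c * Polynomial.X ^ m 0, ?_⟩
    rw [map_mul, map_pow, ofPolynomial_X, ofPolynomial_C, X, AddMonoidAlgebra.single_pow,
      C_mul_single, one_pow, mul_one]
    congr 1
    ext
    simp

/-- The automorphism of `D[x_1, …, x_n]` exchanging `x_i` and `x_j`. -/
noncomputable def swapVars (i j : Fin n) : CentralPoly n D ≃+* CentralPoly n D :=
  AddMonoidAlgebra.mapDomainRingEquiv D (Finsupp.domCongr (Equiv.swap i j))

theorem swapVars_X_left (i j : Fin n) : swapVars i j (X i : CentralPoly n D) = X j := by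
  simp [swapVars, X]

theorem swapVars_C (i j : Fin n) (c : D) : swapVars i j (C c) = C c := by
  simp [swapVars, C]

end Ring

variable {n : ℕ} {D : Type*} [DivisionRing D]

/-! ### Maximal left ideals -/

theorem C_mem_iff {M : Ideal (CentralPoly n D)} (hM : M ≠ ⊤) {c : D} : C c ∈ M ↔ c = 0 := by
  refine ⟨fun h => by_contra fun hc => hM ?_, fun h => ?_⟩
  · exact Ideal.eq_top_of_unit_mem M _ (C c⁻¹) h (by rw [C_mul_C, inv_mul_cancel₀ hc, C_one])
  · rw [h, C, AddMonoidAlgebra.single_zero]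
    exact zero_mem _

theorem pointIdeal_isMaximal {a : Fin n → D} (ha : ∀ i j, a i * a j = a j * a i) :
    (pointIdeal a).IsMaximal := by
  refine ⟨pointIdeal_ne_top ha, fun J hJ => ?_⟩
  obtain ⟨f, hfJ, hfa⟩ := SetLike.exists_of_lt hJ
  obtain ⟨d, hd⟩ := exists_sub_C_mem_pointIdeal a f
  by_contra hJtop
  have hCd : C d ∈ J := by simpa using sub_mem hfJ (hJ.le hd)
  rw [(C_mem_iff hJtop).1 hCd] at hd
  exact hfa (by simpa [C] using hd)

/-- A maximal left ideal of an Amitsur–Small ring in `n` variables contracts to a maximal left ideal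
of `D[x_i]`, for each of the variables `x_i`. -/
theorem comap_ofPolynomial_isMaximal (h : IsAmitsurSmallRing D) {M : Ideal (CentralPoly n D)}
    (hM : M.IsMaximal) (i : Fin n) : (M.comap (ofPolynomial i)).IsMaximal := by
  have hn : 1 ≤ n := i.pos
  let σ : CentralPoly n D ≃+* CentralPoly n D := swapVars (Fin.castLE hn 0) i
  have h₁ : (M.comap σ).IsMaximal := Ideal.comap_isMaximal_of_surjective σ σ.surjective
  have h₂ := h 1 n le_rfl hn _ h₁
  have h₃ := Ideal.comap_isMaximal_of_surjective _ (ofPolynomial_surjective (D := D)) (H := h₂)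
  have hcomp : ofPolynomial i =
      ((σ : CentralPoly n D →+* CentralPoly n D).comp (inclusion D hn)).comp (ofPolynomial 0) := by
    refine Polynomial.ringHom_ext (fun c => ?_) ?_
    · simp only [RingHom.comp_apply, ofPolynomial_C, inclusion_C, RingEquiv.coe_toRingHom, σ,
        swapVars_C]
    · simp only [RingHom.comp_apply, ofPolynomial_X, inclusion_X, RingEquiv.coe_toRingHom, σ,
        swapVars_X_left]
  rw [hcomp]
  exact h₃

end CentralPoly

open CentralPoly in
theorem IsNullstellensatzRing.isAmitsurSmallRing {D : Type*} [DivisionRing D]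
    (h : IsNullstellensatzRing D) : IsAmitsurSmallRing D := by
  intro k n hk hkn M hM
  obtain ⟨a, ha, rfl⟩ := (h n (hk.trans hkn) M).1 hM
  have hmax : (pointIdeal fun i : Fin k => a (Fin.castLE hkn i)).IsMaximal :=
    pointIdeal_isMaximal fun i j => ha _ _
  have hle : (pointIdeal fun i : Fin k => a (Fin.castLE hkn i)) ≤
      (pointIdeal a).comap (inclusion D hkn) := pointIdeal_le_iff.2 fun i => by
    rw [Ideal.mem_comap, map_sub, inclusion_X, inclusion_C]
    exact X_sub_C_mem_pointIdeal a _
  rw [← hmax.eq_of_le (Ideal.comap_ne_top _ hM.ne_top) hle]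
  exact hmax

open CentralPoly in
theorem IsAmitsurSmallRing.isNullstellensatzRing {D : Type*} [DivisionRing D]
    (hD : IsAlgClosedDivisionRing D) (h : IsAmitsurSmallRing D) : IsNullstellensatzRing D := by
  intro n _ M
  refine ⟨fun hM => ?_, fun ⟨a, ha, hMa⟩ => hMa ▸ pointIdeal_isMaximal ha⟩
  have hex (i : Fin n) : ∃ a : D, X i - C a ∈ M := by
    obtain ⟨a, ha⟩ := Polynomial.exists_X_sub_C_mem_of_isMaximal hD
      (comap_ofPolynomial_isMaximal h hM i)
    rw [Ideal.mem_comap, map_sub, ofPolynomial_X, ofPolynomial_C] at ha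
    exact ⟨a, ha⟩
  choose a ha using hex
  have hcomm (i j : Fin n) : a i * a j = a j * a i := by
    rw [← sub_eq_zero, ← C_mem_iff hM.ne_top, ← commutator_X_sub_C i j]
    exact sub_mem (M.mul_mem_left _ (ha j)) (M.mul_mem_left _ (ha i))
  exact ⟨a, hcomm,
    ((pointIdeal_isMaximal hcomm).eq_of_le hM.ne_top (pointIdeal_le_iff.2 ha)).symm⟩

theorem proposition3p3 (D : Type*) [DivisionRing D] (hD : IsAlgClosedDivisionRing D) :
    IsNullstellensatzRing D ↔ IsAmitsurSmallRing D :=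
  ⟨IsNullstellensatzRing.isAmitsurSmallRing, IsAmitsurSmallRing.isNullstellensatzRing hD⟩
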